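/- **Theorem 3.1.** A *Lévy measure* is a (non-negative Borel) measure $G$ on $[0,\infty)$ with $\int_{[0,\infty)}(1\wedge y^{-1})\,G(dy)<\infty$. An *extended Lévy measure* is a pair $(G,g_\infty)$, abbreviated $G$, consisting of a Lévy measure $G$ and a number $g_\infty\ge 0$, called the charge of $y^{-1}G(dy)$ at $\infty$. Integrals of $y^{-1}G(dy)$ over sets containing $\infty$ include this charge: $\int_{[x,\infty]}y^{-1}G(dy)=\int_{[x,\infty)}y^{-1}G(dy)+g_\infty$ for $x>0$. A sequence $G^{(n)}$ of extended Lévy measures *converges* to an extended Lévy measure $G$ if, at every point $x\in(0,\infty)$ of continuity of $x\mapsto\int_{[0,x]}G(dy)$, $$\int_{[0,x]}G^{(n)}(dy)\to\int_{[0,x]}G(dy)\quad\text{and}\quad\int_{[x,\infty]}y^{-1}G^{(n)}(dy)\to\int_{[x,\infty]}y^{-1}G(dy)\qquad(n\to\infty).$$ The first- and second-order Laplace exponents of $G$ are, for $\operatorname{Re}q>0$ and with $g_0=G(\{0\})$, $$\Phi(q)=q\,g_0+g_\infty+\int_{(0,\infty)}\frac{1-e^{-qx}}{x}\,G(dx),\qquad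 \Psi(q)=\tfrac12q^2g_0+q\,g_\infty+\int_{(0,\infty)}\frac{e^{-qx}-1+qx}{x^2}\,G(dx).$$ Let $G^{(n)}$ be a sequence of extended Lévy measures with Laplace exponents $\Phi^{(n)}$ and $\Psi^{(n)}$. Then, taking $n\to\infty$, the following are equivalent: - (i) $G^{(n)}$ converges to some extended Lévy measure $G$; - (ii) $\lim_{n\to\infty}\Phi^{(n)}(q)$ exists (and is finite) for each real $q>0$; - (iii) $\lim_{n\to\infty}\Psi^{(n)}(q)$ exists (and is finite) for each real $q>0$. Moreover, whenever $G^{(n)}$ converges to an extended Lévy measure $G$ with Laplace exponents $\Phi$ and $\Psi$, one has $\Phi^{(n)}(q)\to\Phi(q)$ and $\Psi^{(n)}(q)\to\Psi(q)$ for every real $q>0$. -/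

import Mathlib

open Filter Topology MeasureTheory Set
open scoped NNReal ENNReal

noncomputable section

/-- A Lévy measure: a measure `G` on `[0, ∞)` with `∫ (1 ∧ y⁻¹) G(dy) < ∞`.
The inverse is taken in `[0, ∞]`, so the integrand equals `1` at `y = 0`. -/
def IsLevyMeasure (G : Measure ℝ≥0) : Prop :=
  ∫⁻ y : ℝ≥0, min 1 (y : ℝ≥0∞)⁻¹ ∂G < ∞

/-- An extended Lévy measure on `[0, ∞]`: a pair `(G, g_∞)` of a Lévy measure `G` on `[0, ∞)`
and a number `g_∞ ≥ 0`, the charge of `y⁻¹ G(dy)` at `∞`. -/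
structure ExtLevyMeasure where
  /-- the Lévy measure `G` on `[0, ∞)` -/
  toMeasure : Measure ℝ≥0
  /-- the charge `g_∞` of `y⁻¹ G(dy)` at `∞` -/
  charge : ℝ≥0
  isLevy : IsLevyMeasure toMeasure

namespace ExtLevyMeasure

/-- The distribution function `G(x) = ∫_{[0,x]} G(dy)`. -/
def distrib (G : ExtLevyMeasure) (x : ℝ≥0) : ℝ :=
  (G.toMeasure (Icc 0 x)).toReal

/-- The tail `∫_{[x,∞]} y⁻¹ G(dy)` for `x > 0`, which includes the charge at `∞`. -/
def tail (G : ExtLevyMeasure) (x : ℝ≥0) : ℝ :=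
  (∫ y in Ici x, (y : ℝ)⁻¹ ∂G.toMeasure) + G.charge

/-- Convergence of a sequence of extended Lévy measures `Gs` to `G`: the distribution functions
and the tails converge at every point `x ∈ (0, ∞)` of continuity of `G`. -/
def ConvergesTo (Gs : ℕ → ExtLevyMeasure) (G : ExtLevyMeasure) : Prop :=
  ∀ x : ℝ≥0, 0 < x → ContinuousAt G.distrib x →
    Tendsto (fun n => (Gs n).distrib x) atTop (𝓝 (G.distrib x)) ∧
    Tendsto (fun n => (Gs n).tail x) atTop (𝓝 (G.tail x))

/-- The first-order Laplace exponent
`Φ(q) = ∫_{[0,∞]} (1 - e^{-qx}) x⁻¹ G(dx)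
      = q g₀ + g_∞ + ∫_{(0,∞)} (1 - e^{-qx}) x⁻¹ G(dx)`, `g₀ = G({0})`,
for complex `q` with positive real part. -/
def laplaceOne (G : ExtLevyMeasure) (q : ℂ) : ℂ :=
  q * ((G.toMeasure {0}).toReal : ℂ) + ((G.charge : ℝ) : ℂ)
    + ∫ x in Ioi (0 : ℝ≥0), (1 - Complex.exp (-q * ((x : ℝ) : ℂ))) / ((x : ℝ) : ℂ) ∂G.toMeasure

/-- The second-order Laplace exponent
`Ψ(q) = ∫_{[0,∞]} (e^{-qx} - 1 + qx) x⁻² G(dx)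
      = q² g₀ / 2 + q g_∞ + ∫_{(0,∞)} (e^{-qx} - 1 + qx) x⁻² G(dx)`, `g₀ = G({0})`,
for complex `q` with positive real part. -/
def laplaceTwo (G : ExtLevyMeasure) (q : ℂ) : ℂ :=
  q ^ 2 / 2 * ((G.toMeasure {0}).toReal : ℂ) + q * ((G.charge : ℝ) : ℂ)
    + ∫ x in Ioi (0 : ℝ≥0),
        (Complex.exp (-q * ((x : ℝ) : ℂ)) - 1 + q * ((x : ℝ) : ℂ)) / ((x : ℝ) : ℂ) ^ 2
          ∂G.toMeasure

end ExtLevyMeasure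

end

/-!
An extended Lévy measure `G` is encoded as the finite measure `(1 + y)⁻¹ G(dy) + g_∞ δ_∞` on the
compact space `[0, ∞]`, and convergence of extended Lévy measures becomes weak convergence of these
finite measures. Bounded sets of finite measures on `[0, ∞]` are relatively compact, so weak
convergence follows from the convergence of the integrals of a family of continuous functions with
dense span. For real `q` the Laplace exponents are the integrals of continuous kernels `φ_q` and
`ψ_q` on `[0, ∞]`. The `φ_q` have dense span by Stone–Weierstrass, since
`φ_{q+1} - φ_q = e^{-qy} φ_1`, and so do the `ψ_q`, since `dψ_q/dq = φ_q` uniformly on `[0, ∞]`.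
-/

/-! ### Weak convergence on compact spaces -/

section CompactSpace

variable {X ι : Type*} [TopologicalSpace X] [CompactSpace X] [MeasurableSpace X] [BorelSpace X]
  {l : Filter ι} {S : Set C(X, ℝ)}

theorem integrable_continuousMap (μ : Measure X) [IsFiniteMeasure μ] (f : C(X, ℝ)) :
    Integrable f μ :=
  (BoundedContinuousFunction.mkOfCompact f).integrable μ

/-- Integration against a finite measure on a compact space, as a continuous linear functional on
the space of continuous functions. -/
noncomputable def integralCLM (μ : FiniteMeasure X) : C(X, ℝ) →L[ℝ] ℝ :=
  LinearMap.mkContinuous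
    { toFun := fun f => ∫ x, f x ∂(μ : Measure X)
      map_add' := fun f g =>
        integral_add (integrable_continuousMap _ f) (integrable_continuousMap _ g)
      map_smul' := fun c f => integral_const_mul c f }
    μ.mass fun f =>
      (norm_integral_le_of_norm_le_const (ae_of_all (μ : Measure X) f.norm_coe_le_norm)).trans_eq
        (mul_comm _ _)

theorem integralCLM_apply (μ : FiniteMeasure X) (f : C(X, ℝ)) :
    integralCLM μ f = ∫ x, f x ∂(μ : Measure X) := rfl

theorem norm_integralCLM_le (μ : FiniteMeasure X) : ‖integralCLM μ‖ ≤ μ.mass :=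
  LinearMap.mkContinuous_norm_le _ μ.mass.2 _

theorem integralCLM_one (μ : FiniteMeasure X) : integralCLM μ 1 = μ.mass :=
  (integral_const _).trans (mul_one _)

theorem tendsto_iff_forall_integralCLM_tendsto {ν : ι → FiniteMeasure X} {ν₀ : FiniteMeasure X} :
    Tendsto ν l (𝓝 ν₀) ↔
      ∀ f, Tendsto (fun i => integralCLM (ν i) f) l (𝓝 (integralCLM ν₀ f)) :=
  FiniteMeasure.tendsto_iff_forall_integral_tendsto.trans
    ⟨fun h f => h (BoundedContinuousFunction.mkOfCompact f), fun h f => h f.toContinuousMap⟩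

theorem eq_of_integralCLM_eqOn [HasOuterApproxClosed X]
    (hS : (Submodule.span ℝ S).topologicalClosure = ⊤) {μ ν : FiniteMeasure X}
    (h : EqOn (integralCLM μ) (integralCLM ν) S) : μ = ν := by
  have heq : integralCLM μ = integralCLM ν :=
    ContinuousLinearMap.ext_on (Submodule.dense_iff_topologicalClosure_eq_top.2 hS) h
  exact FiniteMeasure.ext_of_forall_integral_eq fun f => congr($heq f.toContinuousMap)

theorem exists_tendsto_integralCLM_of_mem_span {ν : ι → FiniteMeasure X}
    (h : ∀ f ∈ S, ∃ c, Tendsto (fun i => integralCLM (ν i) f) l (𝓝 c))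
    {f : C(X, ℝ)} (hf : f ∈ Submodule.span ℝ S) :
    ∃ c, Tendsto (fun i => integralCLM (ν i) f) l (𝓝 c) := by
  induction hf using Submodule.span_induction with
  | mem f hf => exact h f hf
  | zero => exact ⟨0, by simpa only [map_zero] using tendsto_const_nhds⟩
  | add f g _ _ hf hg =>
    obtain ⟨a, ha⟩ := hf
    obtain ⟨b, hb⟩ := hg
    exact ⟨a + b, by simpa only [map_add] using ha.add hb⟩
  | smul r f _ hf =>
    obtain ⟨a, ha⟩ := hf
    exact ⟨r • a, by simpa only [map_smul] using ha.const_smul r⟩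

theorem exists_eventually_mass_le (hS : (Submodule.span ℝ S).topologicalClosure = ⊤)
    {ν : ι → FiniteMeasure X}
    (h : ∀ f ∈ S, ∃ c, Tendsto (fun i => integralCLM (ν i) f) l (𝓝 c)) :
    ∃ C : ℝ≥0, ∀ᶠ i in l, (ν i).mass ≤ C := by
  obtain ⟨g, hg, hdist⟩ : ∃ g ∈ Submodule.span ℝ S, dist (1 : C(X, ℝ)) g < 2⁻¹ :=
    (Submodule.dense_iff_topologicalClosure_eq_top.2 hS).exists_dist_lt 1 (by norm_num)
  obtain ⟨c, hc⟩ := exists_tendsto_integralCLM_of_mem_span h hg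
  refine ⟨(2 * (c + 1)).toNNReal, ?_⟩
  filter_upwards [hc.eventually_le_const (lt_add_one c)] with i hi
  have hsub : integralCLM (ν i) (1 - g) ≤ (ν i).mass * 2⁻¹ :=
    (le_abs_self _).trans <| ((integralCLM (ν i)).le_of_opNorm_le (norm_integralCLM_le _) _).trans
      (mul_le_mul_of_nonneg_left (dist_eq_norm (1 : C(X, ℝ)) g ▸ hdist.le) (ν i).mass.2)
  rw [map_sub, integralCLM_one] at hsub
  exact NNReal.le_toNNReal_of_coe_le (by linarith)

theorem exists_tendsto_of_forall_exists_tendsto_integralCLM [T2Space X] [HasOuterApproxClosed X]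
    [l.NeBot] (hS : (Submodule.span ℝ S).topologicalClosure = ⊤) {ν : ι → FiniteMeasure X}
    (h : ∀ f ∈ S, ∃ c, Tendsto (fun i => integralCLM (ν i) f) l (𝓝 c)) :
    ∃ ν₀, Tendsto ν l (𝓝 ν₀) := by
  obtain ⟨C, hC⟩ := exists_eventually_mass_le hS h
  have hK := isCompact_setOfPred_finiteMeasure_le_of_compactSpace X C
  obtain ⟨ν₀, -, hν₀⟩ := hK.exists_mapClusterPt (tendsto_principal.2 hC)
  have hlim : ∀ ρ, MapClusterPt ρ l ν → ∀ f c,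
      Tendsto (fun i => integralCLM (ν i) f) l (𝓝 c) → integralCLM ρ f = c := by
    intro ρ hρ f c hc
    obtain ⟨U, hU, hUρ⟩ := mapClusterPt_iff_ultrafilter.1 hρ
    exact tendsto_nhds_unique (tendsto_iff_forall_integralCLM_tendsto.1 hUρ f) (hc.mono_left hU)
  refine ⟨ν₀, hK.tendsto_nhds_of_unique_mapClusterPt hC fun ρ _ hρ => ?_⟩
  refine eq_of_integralCLM_eqOn hS fun f hf => ?_
  obtain ⟨c, hc⟩ := h f hf
  rw [hlim ρ hρ f c hc, hlim ν₀ hν₀ f c hc]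

end CompactSpace

section Portmanteau

variable {X ι : Type*} [TopologicalSpace X] [MeasurableSpace X] [HasOuterApproxClosed X]
  {l : Filter ι} {ν : ι → FiniteMeasure X} {ν₀ : FiniteMeasure X} {A : Set X}

theorem eventually_measureReal_lt_of_null_frontier [OpensMeasurableSpace X]
    (h : Tendsto ν l (𝓝 ν₀)) (hA : (ν₀ : Measure X) (frontier A) = 0) {b : ℝ}
    (hb : (ν₀ : Measure X).real A < b) : ∀ᶠ i in l, (ν i : Measure X).real A < b := by
  have hclosure : (ν₀ : Measure X) (closure A) < ENNReal.ofReal b := by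
    rwa [measure_closure_of_null_frontier hA, ENNReal.lt_ofReal_iff_toReal_lt (by finiteness)]
  filter_upwards [eventually_lt_of_limsup_lt
    ((FiniteMeasure.limsup_measure_closed_le_of_tendsto h isClosed_closure).trans_lt hclosure)]
    with i hi
  exact (ENNReal.lt_ofReal_iff_toReal_lt (by finiteness)).1
    ((measure_mono subset_closure).trans_lt hi)

theorem tendsto_measureReal_of_null_frontier [OpensMeasurableSpace X]
    (h : Tendsto ν l (𝓝 ν₀)) (hA : (ν₀ : Measure X) (frontier A) = 0) (hm : MeasurableSet A) :
    Tendsto (fun i => (ν i : Measure X).real A) l (𝓝 ((ν₀ : Measure X).real A)) := by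
  refine tendsto_order.2 ⟨fun a ha => ?_, fun b => eventually_measureReal_lt_of_null_frontier h hA⟩
  have hmass : Tendsto (fun i => (ν i : Measure X).real univ) l
      (𝓝 ((ν₀ : Measure X).real univ)) :=
    (NNReal.continuous_coe.tendsto _).comp h.mass
  have hε : 0 < ((ν₀ : Measure X).real A - a) / 2 := half_pos (sub_pos.2 ha)
  filter_upwards [hmass.eventually_const_lt (sub_lt_self _ hε),
    eventually_measureReal_lt_of_null_frontier (A := Aᶜ) h (by rwa [frontier_compl])
      (lt_add_of_pos_right _ hε)] with i hi hic
  linarith [measureReal_add_measureReal_compl (μ := (ν i : Measure X)) hm,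
    measureReal_add_measureReal_compl (μ := (ν₀ : Measure X)) hm]

theorem tendsto_setIntegral_of_null_frontier [CompactSpace X] [BorelSpace X]
    (h : Tendsto ν l (𝓝 ν₀)) (hA : (ν₀ : Measure X) (frontier A) = 0) (hm : MeasurableSet A)
    (f : C(X, ℝ≥0)) :
    Tendsto (fun i => ∫ x in A, (f x : ℝ) ∂(ν i : Measure X)) l
      (𝓝 (∫ x in A, (f x : ℝ) ∂(ν₀ : Measure X))) := by
  have hfin (μ : FiniteMeasure X) : IsFiniteMeasure ((μ : Measure X).withDensity (f ·)) :=
    isFiniteMeasure_withDensity (BoundedContinuousFunction.lintegral_lt_top_of_nnreal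
      (μ : Measure X) (BoundedContinuousFunction.mkOfCompact f)).ne
  have hreal (μ : FiniteMeasure X) :
      ((μ : Measure X).withDensity (f ·)).real A = ∫ x in A, (f x : ℝ) ∂(μ : Measure X) := by
    simpa [NNReal.smul_def] using setIntegral_withDensity_eq_setIntegral_smul
      (μ := (μ : Measure X)) f.continuous.measurable (fun _ => (1 : ℝ)) hm
  let weight (μ : FiniteMeasure X) : FiniteMeasure X := ⟨(μ : Measure X).withDensity (f ·), hfin μ⟩
  have hweight : Tendsto (fun i => weight (ν i)) l (𝓝 (weight ν₀)) := by
    refine tendsto_iff_forall_integralCLM_tendsto.2 fun g => ?_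
    have hmul (μ : FiniteMeasure X) :
        integralCLM (weight μ) g = integralCLM μ ⟨fun x => f x • g x, by fun_prop⟩ :=
      integral_withDensity_eq_integral_smul f.continuous.measurable g
    simpa only [hmul] using tendsto_iff_forall_integralCLM_tendsto.1 h _
  simp only [← hreal]
  exact tendsto_measureReal_of_null_frontier hweight
    (withDensity_absolutelyContinuous _ _ hA) hm

end Portmanteau

theorem topologicalClosure_eq_top_of_pow_mul_mem {X : Type*} [TopologicalSpace X] [CompactSpace X]
    {L : Submodule ℝ C(X, ℝ)} {u w : C(X, ℝ)} (hu : Function.Injective u) (hw : ∀ x, w x ≠ 0)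
    (h : ∀ k : ℕ, u ^ k * w ∈ L) : L.topologicalClosure = ⊤ := by
  have hadjoin : Subalgebra.toSubmodule (Algebra.adjoin ℝ {u}) ≤
      L.comap (LinearMap.mulRight ℝ w) := by
    rw [Algebra.adjoin_eq_span, Submodule.span_le]
    rintro _ hv
    obtain ⟨k, rfl⟩ := Submonoid.mem_closure_singleton.1 hv
    exact h k
  have hdense : (Algebra.adjoin ℝ {u}).topologicalClosure = ⊤ :=
    ContinuousMap.subalgebra_topologicalClosure_eq_top_of_separatesPoints _ fun x y hxy =>
      ⟨u, ⟨u, Algebra.self_mem_adjoin_singleton ℝ u, rfl⟩, hu.ne hxy⟩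
  refine (Submodule.eq_top_iff').2 fun g => ?_
  let r : C(X, ℝ) := ⟨fun x => g x / w x, g.continuous.div w.continuous hw⟩
  have hr : r * w = g := ContinuousMap.ext fun x => div_mul_cancel₀ _ (hw x)
  have hmem : r ∈ (Algebra.adjoin ℝ {u}).topologicalClosure := hdense ▸ Algebra.mem_top
  exact hr ▸ map_mem_closure (f := (· * w)) (continuous_mul_const w) hmem hadjoin

/-! ### Laplace kernels on `[0, ∞]` -/

/-- The function `y ↦ e⁻ʸ` on `[0, ∞]`, with value `0` at `∞`; it serves as a coordinate on this
compact space. -/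
noncomputable def expNeg : C(ℝ≥0∞, ℝ) where
  toFun y := (EReal.exp (-(y : EReal))).toReal
  continuous_toFun := by
    refine continuous_iff_continuousAt.2 fun y => ?_
    refine (ENNReal.continuousAt_toReal ?_).comp
      (ENNReal.continuous_exp.comp (continuous_neg.comp continuous_coe_ennreal_ereal)).continuousAt
    simp

theorem expNeg_coe (y : ℝ≥0) : expNeg y = Real.exp (-y) := by
  change (EReal.exp (-((y : ℝ) : EReal))).toReal = _
  rw [← EReal.coe_neg, EReal.exp_coe, ENNReal.toReal_ofReal (Real.exp_nonneg _)]

theorem expNeg_top : expNeg ∞ = 0 := by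
  simp [expNeg]

theorem expNeg_coe_rpow (y : ℝ≥0) (t : ℝ) : expNeg y ^ t = Real.exp (-(t * y)) := by
  rw [expNeg_coe, ← Real.exp_mul]
  ring_nf

theorem expNeg_nonneg (y : ℝ≥0∞) : 0 ≤ expNeg y := ENNReal.toReal_nonneg

theorem expNeg_le_one (y : ℝ≥0∞) : expNeg y ≤ 1 := by
  induction y with
  | top => simp [expNeg_top]
  | coe y => simp [expNeg_coe]

theorem injective_expNeg : Function.Injective expNeg := by
  intro y z h
  induction y <;> induction z <;>
    simp_all [expNeg_top, expNeg_coe, (Real.exp_pos _).ne, (Real.exp_pos _).ne']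

theorem continuous_integral_expNeg_rpow (q : ℝ≥0) :
    Continuous fun y => ∫ t in (0 : ℝ)..q, expNeg y ^ t := by
  refine intervalIntegral.continuous_of_dominated_interval (bound := fun _ => 1)
    (fun y => (measurable_const.pow measurable_id).aestronglyMeasurable)
    (fun y => ae_of_all _ fun t ht => ?_) intervalIntegrable_const
    (ae_of_all _ fun t ht => ?_)
  all_goals rw [uIoc_of_le q.coe_nonneg] at ht
  · rw [Real.norm_of_nonneg (Real.rpow_nonneg (expNeg_nonneg y) t)]
    exact Real.rpow_le_one (expNeg_nonneg y) (expNeg_le_one y) ht.1.le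
  · exact (Real.continuous_rpow_const ht.1.le).comp expNeg.continuous

/-- The continuous extension to `[0, ∞]` of `y ↦ (1 + y) (1 - e^{-qy}) / y`, the integrand of the
first-order Laplace exponent against `y⁻¹ G(dy)`, rescaled by `1 + y`. The integral term extends
`(1 - e^{-qy}) / y`. -/
noncomputable def laplaceKernelOne (q : ℝ≥0) : C(ℝ≥0∞, ℝ) where
  toFun y := 1 - expNeg y ^ (q : ℝ) + ∫ t in (0 : ℝ)..q, expNeg y ^ t
  continuous_toFun :=
    (continuous_const.sub ((Real.continuous_rpow_const q.2).comp expNeg.continuous)).add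
      (continuous_integral_expNeg_rpow q)

theorem laplaceKernelOne_apply (q : ℝ≥0) (y : ℝ≥0∞) :
    laplaceKernelOne q y = 1 - expNeg y ^ (q : ℝ) + ∫ t in (0 : ℝ)..q, expNeg y ^ t := rfl

theorem mul_integral_exp_neg_mul (q y : ℝ) :
    y * ∫ t in (0 : ℝ)..q, Real.exp (-(t * y)) = 1 - Real.exp (-(q * y)) := by
  rw [intervalIntegral.mul_integral_comp_mul_right (f := fun x => Real.exp (-x))]
  simp

theorem laplaceKernelOne_coe (q y : ℝ≥0) :
    laplaceKernelOne q y = (1 + y) * ∫ t in (0 : ℝ)..q, Real.exp (-(t * y)) := by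
  simp only [laplaceKernelOne_apply, expNeg_coe_rpow]
  linear_combination -mul_integral_exp_neg_mul q y

theorem laplaceKernelOne_zero (q : ℝ≥0) : laplaceKernelOne q 0 = q := by
  simpa using laplaceKernelOne_coe q 0

theorem laplaceKernelOne_top {q : ℝ≥0} (hq : 0 < q) : laplaceKernelOne q ∞ = 1 := by
  have hzero : ∫ t in (0 : ℝ)..q, expNeg ∞ ^ t = 0 := by
    refine intervalIntegral.integral_zero_ae (ae_of_all _ fun t ht => ?_)
    rw [uIoc_of_le q.coe_nonneg] at ht
    rw [expNeg_top, Real.zero_rpow ht.1.ne']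
  rw [laplaceKernelOne_apply, hzero, expNeg_top, Real.zero_rpow (by positivity), sub_zero, add_zero]

theorem integral_exp_neg_mul_add (q t y : ℝ) :
    ∫ s in (0 : ℝ)..q + t, Real.exp (-(s * y)) =
      (∫ s in (0 : ℝ)..q, Real.exp (-(s * y))) +
        Real.exp (-(q * y)) * ∫ s in (0 : ℝ)..t, Real.exp (-(s * y)) := by
  have hint (a b : ℝ) : IntervalIntegrable (fun s => Real.exp (-(s * y))) volume a b :=
    Continuous.intervalIntegrable (by fun_prop) a b
  have hshift : ∫ s in q..q + t, Real.exp (-(s * y)) =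
      ∫ s in (0 : ℝ)..t, Real.exp (-(q * y)) * Real.exp (-(s * y)) := by
    have := intervalIntegral.integral_comp_add_left (a := 0) (b := t)
      (fun s => Real.exp (-(s * y))) q
    rw [add_zero] at this
    rw [← this]
    congr with s
    rw [← Real.exp_add]
    ring_nf
  rw [← intervalIntegral.integral_add_adjacent_intervals (hint 0 q) (hint q (q + t)), hshift,
    intervalIntegral.integral_const_mul]

theorem laplaceKernelOne_index_zero : laplaceKernelOne 0 = 0 := by
  ext y
  simp [laplaceKernelOne_apply]

theorem laplaceKernelOne_add (q t : ℝ≥0) (y : ℝ≥0∞) :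
    laplaceKernelOne (q + t) y =
      laplaceKernelOne q y + expNeg y ^ (q : ℝ) * laplaceKernelOne t y := by
  rcases eq_zero_or_pos q with rfl | hq
  · simp [laplaceKernelOne_index_zero]
  induction y with
  | top =>
    rw [laplaceKernelOne_top hq, laplaceKernelOne_top (add_pos_of_pos_of_nonneg hq t.2),
      expNeg_top, Real.zero_rpow (by positivity), zero_mul, add_zero]
  | coe y =>
    simp only [laplaceKernelOne_coe, expNeg_coe_rpow, NNReal.coe_add, integral_exp_neg_mul_add]
    ring

theorem laplaceKernelOne_pos {q : ℝ≥0} (hq : 0 < q) (y : ℝ≥0∞) : 0 < laplaceKernelOne q y := by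
  induction y with
  | top => simp [laplaceKernelOne_top hq]
  | coe y =>
    rw [laplaceKernelOne_coe]
    exact mul_pos (by positivity) (intervalIntegral.intervalIntegral_pos_of_pos
      (Continuous.intervalIntegrable (by fun_prop) _ _) (fun _ => Real.exp_pos _) hq)

theorem laplaceKernelOne_coe_le (q y : ℝ≥0) : laplaceKernelOne q y ≤ (1 + y) * q := by
  have hle : ∫ t in (0 : ℝ)..q, Real.exp (-(t * y)) ≤ ∫ _ in (0 : ℝ)..q, (1 : ℝ) :=
    intervalIntegral.integral_mono_on q.coe_nonneg
      (Continuous.intervalIntegrable (by fun_prop) _ _) intervalIntegrable_const fun t ht =>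
        Real.exp_le_one_iff.2 (neg_nonpos.2 (mul_nonneg ht.1 y.2))
  rw [laplaceKernelOne_coe]
  refine mul_le_mul_of_nonneg_left (hle.trans_eq ?_) (by positivity)
  rw [intervalIntegral.integral_const, sub_zero, smul_eq_mul, mul_one]

theorem laplaceKernelOne_nonneg (q : ℝ≥0) (y : ℝ≥0∞) : 0 ≤ laplaceKernelOne q y := by
  rcases eq_zero_or_pos q with rfl | hq
  · rw [laplaceKernelOne_index_zero, ContinuousMap.zero_apply]
  · exact (laplaceKernelOne_pos hq y).le

theorem monotone_laplaceKernelOne (y : ℝ≥0∞) : Monotone fun q => laplaceKernelOne q y := by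
  intro q r hqr
  obtain ⟨t, rfl⟩ := exists_add_of_le hqr
  simp only [laplaceKernelOne_add]
  exact le_add_of_nonneg_right
    (mul_nonneg (Real.rpow_nonneg (expNeg_nonneg y) _) (laplaceKernelOne_nonneg t y))

theorem one_add_mul_exp_neg_mul_le {q y : ℝ} (hq : 0 < q) (hy : 0 ≤ y) :
    (1 + y) * Real.exp (-(q * y)) ≤ 1 + q⁻¹ := by
  have hexp : q * y ≤ Real.exp (q * y) := by linarith [Real.add_one_le_exp (q * y)]
  rw [Real.exp_neg, ← div_eq_mul_inv, div_le_iff₀ (Real.exp_pos _)]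
  calc 1 + y = 1 + q⁻¹ * (q * y) := by field_simp
    _ ≤ Real.exp (q * y) + q⁻¹ * Real.exp (q * y) := by
      gcongr
      exact Real.one_le_exp (by positivity)
    _ = (1 + q⁻¹) * Real.exp (q * y) := by ring

theorem abs_laplaceKernelOne_sub_le {q : ℝ≥0} (hq : 0 < q) (t : ℝ≥0) (y : ℝ≥0∞) :
    |laplaceKernelOne (q + t) y - laplaceKernelOne q y| ≤ (1 + (q : ℝ)⁻¹) * t := by
  have hle : laplaceKernelOne q y ≤ laplaceKernelOne (q + t) y :=
    monotone_laplaceKernelOne y le_self_add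
  rw [abs_of_nonneg (sub_nonneg.2 hle), laplaceKernelOne_add, add_sub_cancel_left]
  induction y with
  | top =>
    rw [expNeg_top, Real.zero_rpow (by positivity), zero_mul]
    positivity
  | coe y =>
    calc expNeg y ^ (q : ℝ) * laplaceKernelOne t y
        ≤ Real.exp (-(q * y)) * ((1 + y) * t) := by
          rw [expNeg_coe_rpow]
          gcongr
          exact laplaceKernelOne_coe_le t y
      _ = (1 + y) * Real.exp (-(q * y)) * t := by ring
      _ ≤ (1 + (q : ℝ)⁻¹) * t := by
          gcongr
          exact one_add_mul_exp_neg_mul_le hq y.2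

theorem topologicalClosure_span_laplaceKernelOne :
    (Submodule.span ℝ (laplaceKernelOne '' Ioi 0)).topologicalClosure = ⊤ := by
  refine topologicalClosure_eq_top_of_pow_mul_mem injective_expNeg
    (fun y => (laplaceKernelOne_pos one_pos y).ne') fun k => ?_
  have hmem (q : ℝ≥0) : laplaceKernelOne q ∈ Submodule.span ℝ (laplaceKernelOne '' Ioi 0) := by
    rcases eq_zero_or_pos q with rfl | hq
    · exact laplaceKernelOne_index_zero ▸ Submodule.zero_mem _
    · exact Submodule.subset_span (mem_image_of_mem _ hq)
  have hdiff : expNeg ^ k * laplaceKernelOne 1 = laplaceKernelOne (k + 1) - laplaceKernelOne k := by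
    ext y
    simp [laplaceKernelOne_add]
  exact hdiff ▸ Submodule.sub_mem _ (hmem _) (hmem _)

theorem monotone_laplaceKernelOne_toNNReal (y : ℝ≥0∞) :
    Monotone fun t : ℝ => laplaceKernelOne t.toNNReal y :=
  fun _ _ h => monotone_laplaceKernelOne y (Real.toNNReal_le_toNNReal h)

theorem intervalIntegrable_laplaceKernelOne (y : ℝ≥0∞) (a b : ℝ) :
    IntervalIntegrable (fun t => laplaceKernelOne t.toNNReal y) volume a b :=
  (monotone_laplaceKernelOne_toNNReal y).intervalIntegrable

theorem continuous_integral_laplaceKernelOne (q : ℝ≥0) :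
    Continuous fun y => ∫ t in (0 : ℝ)..q, laplaceKernelOne t.toNNReal y := by
  refine intervalIntegral.continuous_of_dominated_interval
    (bound := fun _ => ‖laplaceKernelOne q‖)
    (fun y => (monotone_laplaceKernelOne_toNNReal y).measurable.aestronglyMeasurable)
    (fun y => ae_of_all _ fun t ht => ?_) intervalIntegrable_const
    (ae_of_all _ fun t _ => (laplaceKernelOne _).continuous)
  rw [uIoc_of_le q.coe_nonneg] at ht
  rw [Real.norm_of_nonneg (laplaceKernelOne_nonneg _ y)]
  exact (monotone_laplaceKernelOne y (Real.toNNReal_le_iff_le_coe.2 ht.2)).trans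
    ((le_abs_self _).trans ((laplaceKernelOne q).norm_coe_le_norm y))

/-- The continuous extension to `[0, ∞]` of `y ↦ (1 + y) (e^{-qy} - 1 + qy) / y²`, the integrand of
the second-order Laplace exponent against `y⁻¹ G(dy)`, rescaled by `1 + y`. It is encoded through
the identity `Ψ' = Φ` between Laplace exponents. -/
noncomputable def laplaceKernelTwo (q : ℝ≥0) : C(ℝ≥0∞, ℝ) where
  toFun y := ∫ t in (0 : ℝ)..q, laplaceKernelOne t.toNNReal y
  continuous_toFun := continuous_integral_laplaceKernelOne q

theorem laplaceKernelTwo_apply (q : ℝ≥0) (y : ℝ≥0∞) :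
    laplaceKernelTwo q y = ∫ t in (0 : ℝ)..q, laplaceKernelOne t.toNNReal y := rfl

theorem laplaceKernelTwo_add_sub (q h : ℝ≥0) (y : ℝ≥0∞) :
    laplaceKernelTwo (q + h) y - laplaceKernelTwo q y =
      ∫ t in (q : ℝ)..q + h, laplaceKernelOne t.toNNReal y :=
  intervalIntegral.integral_interval_sub_left (intervalIntegrable_laplaceKernelOne y _ _)
    (intervalIntegrable_laplaceKernelOne y _ _)

theorem laplaceKernelTwo_top (q : ℝ≥0) : laplaceKernelTwo q ∞ = q := by
  have heq : ∫ t in (0 : ℝ)..q, laplaceKernelOne t.toNNReal ∞ = ∫ _ in (0 : ℝ)..q, (1 : ℝ) := by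
    refine intervalIntegral.integral_congr_ae (ae_of_all _ fun t ht => ?_)
    rw [uIoc_of_le q.coe_nonneg] at ht
    exact laplaceKernelOne_top (Real.toNNReal_pos.2 ht.1)
  simpa [laplaceKernelTwo_apply] using heq

theorem laplaceKernelTwo_zero (q : ℝ≥0) : laplaceKernelTwo q 0 = (q : ℝ) ^ 2 / 2 := by
  have heq : ∫ t in (0 : ℝ)..q, laplaceKernelOne t.toNNReal 0 = ∫ t in (0 : ℝ)..q, t := by
    refine intervalIntegral.integral_congr fun t ht => ?_
    rw [uIcc_of_le q.coe_nonneg] at ht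
    simp [laplaceKernelOne_zero, ht.1]
  simpa [laplaceKernelTwo_apply] using heq

theorem laplaceKernelOne_coe_of_ne_zero (q : ℝ≥0) {y : ℝ≥0} (hy : y ≠ 0) :
    laplaceKernelOne q y = (1 + y) * ((1 - Real.exp (-(q * y))) / y) := by
  rw [laplaceKernelOne_coe, ← mul_integral_exp_neg_mul, mul_div_cancel_left₀ _ (by positivity)]

theorem laplaceKernelTwo_coe_of_ne_zero (q : ℝ≥0) {y : ℝ≥0} (hy : y ≠ 0) :
    laplaceKernelTwo q y = (1 + y) * ((Real.exp (-(q * y)) - 1 + q * y) / (y : ℝ) ^ 2) := by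
  have hy' : (y : ℝ) ≠ 0 := by positivity
  have heq : ∫ t in (0 : ℝ)..q, laplaceKernelOne t.toNNReal y =
      ∫ t in (0 : ℝ)..q, (1 + y) / y * (1 - Real.exp (-(t * y))) := by
    refine intervalIntegral.integral_congr fun t ht => ?_
    rw [uIcc_of_le q.coe_nonneg] at ht
    simp only [laplaceKernelOne_coe_of_ne_zero _ hy, Real.coe_toNNReal t ht.1]
    ring
  have hint : ∫ t in (0 : ℝ)..q, (1 - Real.exp (-(t * y))) =
      q - (1 - Real.exp (-(q * y))) / y := by
    rw [intervalIntegral.integral_sub intervalIntegrable_const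
      (Continuous.intervalIntegrable (by fun_prop) _ _), ← mul_integral_exp_neg_mul,
      mul_div_cancel_left₀ _ hy']
    simp
  rw [laplaceKernelTwo_apply, heq, intervalIntegral.integral_const_mul, hint]
  field_simp
  ring

theorem abs_laplaceKernelTwo_sub_sub_le {q : ℝ≥0} (hq : 0 < q) (h : ℝ≥0) (y : ℝ≥0∞) :
    |laplaceKernelTwo (q + h) y - laplaceKernelTwo q y - h * laplaceKernelOne q y| ≤
      (1 + (q : ℝ)⁻¹) * h * h := by
  have hconst : ∫ _ in (q : ℝ)..q + h, laplaceKernelOne q y = h * laplaceKernelOne q y := by simp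
  have hbound : ‖∫ t in (q : ℝ)..q + h, (laplaceKernelOne t.toNNReal y - laplaceKernelOne q y)‖ ≤
      (1 + (q : ℝ)⁻¹) * h * |(q : ℝ) + h - q| := by
    refine intervalIntegral.norm_integral_le_of_norm_le_const fun t ht => ?_
    rw [uIoc_of_le (le_add_of_nonneg_right h.coe_nonneg)] at ht
    obtain ⟨s, hs⟩ := exists_add_of_le (NNReal.le_toNNReal_of_coe_le ht.1.le)
    have hsh : q + s ≤ q + h := hs ▸ Real.toNNReal_le_iff_le_coe.2 ht.2
    rw [hs]
    refine (abs_laplaceKernelOne_sub_le hq s y).trans ?_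
    gcongr
    exact le_of_add_le_add_left hsh
  rwa [intervalIntegral.integral_sub (intervalIntegrable_laplaceKernelOne y _ _)
    intervalIntegrable_const, hconst, ← laplaceKernelTwo_add_sub, add_sub_cancel_left,
    NNReal.abs_eq] at hbound

theorem norm_slope_laplaceKernelTwo_sub_le {q h : ℝ≥0} (hq : 0 < q) (hh : 0 < h) :
    ‖(h : ℝ)⁻¹ • (laplaceKernelTwo (q + h) - laplaceKernelTwo q) - laplaceKernelOne q‖ ≤
      (1 + (q : ℝ)⁻¹) * h := by
  refine (ContinuousMap.norm_le _ (by positivity)).2 fun y => ?_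
  have hh' : (0 : ℝ) < h := hh
  calc ‖(h : ℝ)⁻¹ * (laplaceKernelTwo (q + h) y - laplaceKernelTwo q y) - laplaceKernelOne q y‖
      = |laplaceKernelTwo (q + h) y - laplaceKernelTwo q y - h * laplaceKernelOne q y| / h := by
        rw [Real.norm_eq_abs, ← abs_of_pos hh', ← abs_div, abs_of_pos hh']
        field_simp
    _ ≤ (1 + (q : ℝ)⁻¹) * h :=
        (div_le_iff₀ hh').2 (abs_laplaceKernelTwo_sub_sub_le hq h y)

theorem tendsto_slope_laplaceKernelTwo {q : ℝ≥0} (hq : 0 < q) :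
    Tendsto (fun h : ℝ≥0 => (h : ℝ)⁻¹ • (laplaceKernelTwo (q + h) - laplaceKernelTwo q)) (𝓝[>] 0)
      (𝓝 (laplaceKernelOne q)) := by
  refine tendsto_iff_norm_sub_tendsto_zero.2 (squeeze_zero' (.of_forall fun _ => norm_nonneg _)
    (eventually_mem_nhdsWithin.mono fun h hh => norm_slope_laplaceKernelTwo_sub_le hq hh) ?_)
  have hcont : Continuous fun h : ℝ≥0 => (1 + (q : ℝ)⁻¹) * h := by fun_prop
  simpa using hcont.continuousWithinAt.tendsto (x := 0) (s := Ioi 0)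

theorem topologicalClosure_span_laplaceKernelTwo :
    (Submodule.span ℝ (laplaceKernelTwo '' Ioi 0)).topologicalClosure = ⊤ := by
  rw [eq_top_iff, ← topologicalClosure_span_laplaceKernelOne]
  refine Submodule.topologicalClosure_minimal _ (Submodule.span_le.2 ?_)
    (Submodule.isClosed_topologicalClosure _)
  rintro _ ⟨q, hq, rfl⟩
  refine mem_closure_of_tendsto (tendsto_slope_laplaceKernelTwo hq) (.of_forall fun h => ?_)
  exact Submodule.smul_mem _ _ (Submodule.sub_mem _
    (Submodule.subset_span (mem_image_of_mem _ (add_pos_of_pos_of_nonneg hq h.2)))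
    (Submodule.subset_span (mem_image_of_mem _ hq)))

/-! ### Extended Lévy measures as finite measures on `[0, ∞]` -/

theorem measurableEmbedding_coe_ennreal : MeasurableEmbedding ((↑) : ℝ≥0 → ℝ≥0∞) :=
  ENNReal.isOpenEmbedding_coe.measurableEmbedding

/-- The weight `1 + z` on `[0, ∞]`, truncated to `1 + c` beyond `c`, so that it is continuous and
finite at `∞`. -/
noncomputable def truncatedOneAdd (c : ℝ≥0) : C(ℝ≥0∞, ℝ≥0) where
  toFun z := 1 + (min z c).toNNReal
  continuous_toFun := continuous_const.add <| continuous_iff_continuousAt.2 fun z =>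
    (ENNReal.tendsto_toNNReal (by simp)).comp (by fun_prop : Continuous _).continuousAt

theorem truncatedOneAdd_of_le {c y : ℝ≥0} (h : y ≤ c) : truncatedOneAdd c y = 1 + y := by
  simp [truncatedOneAdd, h]

theorem truncatedOneAdd_zero (c : ℝ≥0) : truncatedOneAdd c 0 = 1 := by
  simp [truncatedOneAdd]

theorem one_le_truncatedOneAdd (c : ℝ≥0) (z : ℝ≥0∞) : 1 ≤ truncatedOneAdd c z :=
  le_self_add

theorem isLevyMeasure_withDensity_one_add (μ : Measure ℝ≥0) [IsFiniteMeasure μ] :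
    IsLevyMeasure (μ.withDensity fun y => 1 + y) := by
  have hle (y : ℝ≥0) : (1 + y : ℝ≥0∞) * min 1 (y : ℝ≥0∞)⁻¹ ≤ 2 := by
    rw [add_mul, one_mul, ← one_add_one_eq_two]
    exact add_le_add (min_le_left _ _)
      ((mul_le_mul_right (min_le_right _ _) _).trans (ENNReal.mul_inv_le_one _))
  rw [IsLevyMeasure, lintegral_withDensity_eq_lintegral_mul _ (by fun_prop) (by fun_prop)]
  exact (lintegral_mono hle).trans_lt (by simp [ENNReal.mul_lt_top])

namespace ExtLevyMeasure

theorem lintegral_inv_one_add_lt_top (G : ExtLevyMeasure) :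
    ∫⁻ y, ((1 + y)⁻¹ : ℝ≥0) ∂G.toMeasure < ∞ := by
  refine (lintegral_mono fun y => ?_).trans_lt G.isLevy
  rw [ENNReal.coe_inv (by positivity)]
  refine le_min (ENNReal.inv_le_one.2 ?_) (ENNReal.inv_le_inv.2 ?_) <;> simp

/-- An extended Lévy measure `(G, g_∞)` encoded as the finite measure `(1 + y)⁻¹ G(dy) + g_∞ δ_∞`
on the compact space `[0, ∞]`. -/
noncomputable def toFiniteMeasure (G : ExtLevyMeasure) : FiniteMeasure ℝ≥0∞ :=
  ⟨(G.toMeasure.withDensity fun y => ((1 + y)⁻¹ : ℝ≥0)).map (↑) + G.charge • Measure.dirac ∞,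
    have := isFiniteMeasure_withDensity G.lintegral_inv_one_add_lt_top.ne
    inferInstance⟩

theorem coe_toFiniteMeasure (G : ExtLevyMeasure) : (G.toFiniteMeasure : Measure ℝ≥0∞) =
    (G.toMeasure.withDensity fun y => ((1 + y)⁻¹ : ℝ≥0)).map (↑) + G.charge • Measure.dirac ∞ :=
  rfl

theorem surjective_toFiniteMeasure : Function.Surjective toFiniteMeasure := by
  intro ν
  have hinv : (fun y : ℝ≥0 => (((1 + y)⁻¹ : ℝ≥0) : ℝ≥0∞)) = fun y : ℝ≥0 => (1 + y : ℝ≥0∞)⁻¹ := by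
    ext y
    simp [ENNReal.coe_inv]
  refine ⟨⟨_, ν {∞}, isLevyMeasure_withDensity_one_add (.comap (↑) (ν : Measure ℝ≥0∞))⟩,
    FiniteMeasure.toMeasure_injective ?_⟩
  rw [coe_toFiniteMeasure, hinv, withDensity_inv_same (by fun_prop) (by simp) (by simp),
    measurableEmbedding_coe_ennreal.map_comap, ENNReal.range_coe]
  have hdirac : ν {∞} • Measure.dirac ∞ = (ν : Measure ℝ≥0∞).restrict {∞} := by
    rw [Measure.restrict_singleton, ← FiniteMeasure.ennreal_coeFn_eq_coeFn_toMeasure]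
    rfl
  rw [hdirac, Measure.restrict_compl_add_restrict (measurableSet_singleton ∞)]

theorem setIntegral_toFiniteMeasure (G : ExtLevyMeasure) {A : Set ℝ≥0∞} (hA : MeasurableSet A)
    (f : C(ℝ≥0∞, ℝ)) :
    ∫ z in A, f z ∂(G.toFiniteMeasure : Measure ℝ≥0∞) =
      (∫ y : ℝ≥0 in (↑) ⁻¹' A, (1 + (y : ℝ))⁻¹ * f y ∂G.toMeasure) +
        G.charge * A.indicator f ∞ := by
  have := isFiniteMeasure_withDensity G.lintegral_inv_one_add_lt_top.ne
  rw [coe_toFiniteMeasure, Measure.restrict_add, integral_add_measure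
    (integrable_continuousMap _ f) (integrable_continuousMap _ f),
    measurableEmbedding_coe_ennreal.setIntegral_map,
    setIntegral_withDensity_eq_setIntegral_smul (by fun_prop) _
      (measurableEmbedding_coe_ennreal.measurable hA),
    Measure.restrict_smul, integral_smul_nnreal_measure, ← integral_indicator hA, integral_dirac]
  rfl

theorem distrib_eq_setIntegral (G : ExtLevyMeasure) (x : ℝ≥0) :
    G.distrib x = ∫ z in Iic (x : ℝ≥0∞), (truncatedOneAdd x z : ℝ)
      ∂(G.toFiniteMeasure : Measure ℝ≥0∞) := by
  have hpre : ((↑) : ℝ≥0 → ℝ≥0∞) ⁻¹' Iic x = Icc 0 x := by ext; simp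
  have hone : ∀ y ∈ Icc 0 x, (1 + (y : ℝ))⁻¹ * truncatedOneAdd x y = 1 := fun y hy => by
    rw [truncatedOneAdd_of_le hy.2, NNReal.coe_add, NNReal.coe_one, inv_mul_cancel₀ (by positivity)]
  refine Eq.symm <| (G.setIntegral_toFiniteMeasure measurableSet_Iic
    ⟨fun z => truncatedOneAdd x z, by fun_prop⟩).trans ?_
  simp only [ContinuousMap.coe_mk]
  rw [hpre, setIntegral_congr_fun measurableSet_Icc hone, indicator_of_notMem (by simp), mul_zero,
    add_zero, setIntegral_const, smul_eq_mul, mul_one, distrib, measureReal_def]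

theorem tail_eq_setIntegral (G : ExtLevyMeasure) {x : ℝ≥0} (hx : 0 < x) :
    G.tail x = ∫ z in Ici (x : ℝ≥0∞), (truncatedOneAdd x⁻¹ z⁻¹ : ℝ)
      ∂(G.toFiniteMeasure : Measure ℝ≥0∞) := by
  have hpre : ((↑) : ℝ≥0 → ℝ≥0∞) ⁻¹' Ici x = Ici x := by ext; simp
  have hinv : ∀ y ∈ Ici x, (1 + (y : ℝ))⁻¹ * truncatedOneAdd x⁻¹ (y : ℝ≥0∞)⁻¹ = (y : ℝ)⁻¹ := by
    intro y (hy : x ≤ y)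
    have hy0 : y ≠ 0 := (hx.trans_le hy).ne'
    rw [← ENNReal.coe_inv hy0, truncatedOneAdd_of_le (inv_anti₀ hx hy)]
    push_cast
    field_simp
    ring
  refine Eq.symm <| (G.setIntegral_toFiniteMeasure measurableSet_Ici
    ⟨fun z => truncatedOneAdd x⁻¹ z⁻¹, by fun_prop⟩).trans ?_
  simp only [ContinuousMap.coe_mk]
  rw [hpre, setIntegral_congr_fun measurableSet_Ici hinv, indicator_of_mem (mem_Ici.2 le_top)]
  simp [tail, truncatedOneAdd_zero]

theorem integralCLM_toFiniteMeasure (G : ExtLevyMeasure) (f : C(ℝ≥0∞, ℝ)) :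
    integralCLM G.toFiniteMeasure f = (∫ y : ℝ≥0 in Ioi 0, (1 + (y : ℝ))⁻¹ * f y ∂G.toMeasure) +
      (G.toMeasure {0}).toReal * f 0 + G.charge * f ∞ := by
  have hzero : ((↑) : ℝ≥0 → ℝ≥0∞) ⁻¹' {0} = {0} := by ext; simp
  have hpos : ((↑) : ℝ≥0 → ℝ≥0∞) ⁻¹' {0}ᶜ = Ioi 0 := by ext; simp [pos_iff_ne_zero]
  have hsplit := integral_add_compl (measurableSet_singleton (0 : ℝ≥0∞))
    (integrable_continuousMap (G.toFiniteMeasure : Measure ℝ≥0∞) f)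
  rw [integralCLM_apply, ← hsplit, setIntegral_toFiniteMeasure _ (measurableSet_singleton 0),
    setIntegral_toFiniteMeasure _ (measurableSet_singleton 0).compl, hzero, hpos,
    integral_singleton, indicator_of_notMem (by simp), indicator_of_mem (by simp)]
  simp only [measureReal_def, NNReal.coe_zero, add_zero, inv_one, ENNReal.coe_zero, one_mul,
    smul_eq_mul, mul_zero]
  ring

theorem laplaceOne_ofReal (G : ExtLevyMeasure) {q : ℝ≥0} (hq : 0 < q) :
    G.laplaceOne (q : ℝ) = (integralCLM G.toFiniteMeasure (laplaceKernelOne q) : ℂ) := by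
  have hint : ∫ x in Ioi (0 : ℝ≥0), (1 - Complex.exp (-(q : ℝ) * ((x : ℝ) : ℂ))) / ((x : ℝ) : ℂ)
      ∂G.toMeasure =
        ((∫ y in Ioi (0 : ℝ≥0), (1 + (y : ℝ))⁻¹ * laplaceKernelOne q y ∂G.toMeasure : ℝ) : ℂ) := by
    rw [← integral_complex_ofReal]
    refine setIntegral_congr_fun measurableSet_Ioi fun y hy => ?_
    rw [laplaceKernelOne_coe_of_ne_zero q (ne_of_gt hy), inv_mul_cancel_left₀ (by positivity)]
    push_cast
    simp
  rw [laplaceOne, hint, integralCLM_toFiniteMeasure, laplaceKernelOne_zero, laplaceKernelOne_top hq]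
  push_cast
  ring

theorem laplaceTwo_ofReal (G : ExtLevyMeasure) (q : ℝ≥0) :
    G.laplaceTwo (q : ℝ) = (integralCLM G.toFiniteMeasure (laplaceKernelTwo q) : ℂ) := by
  have hint : ∫ x in Ioi (0 : ℝ≥0), (Complex.exp (-(q : ℝ) * ((x : ℝ) : ℂ)) - 1 +
      (q : ℝ) * ((x : ℝ) : ℂ)) / ((x : ℝ) : ℂ) ^ 2 ∂G.toMeasure =
        ((∫ y in Ioi (0 : ℝ≥0), (1 + (y : ℝ))⁻¹ * laplaceKernelTwo q y ∂G.toMeasure : ℝ) : ℂ) := by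
    rw [← integral_complex_ofReal]
    refine setIntegral_congr_fun measurableSet_Ioi fun y hy => ?_
    rw [laplaceKernelTwo_coe_of_ne_zero q (ne_of_gt hy), inv_mul_cancel_left₀ (by positivity)]
    push_cast
    simp
  rw [laplaceTwo, hint, integralCLM_toFiniteMeasure, laplaceKernelTwo_zero, laplaceKernelTwo_top]
  push_cast
  ring

end ExtLevyMeasure

theorem exists_continuousAt_of_monotone {f g : ℝ≥0 → ℝ} (hf : Monotone f) (hg : Monotone g)
    {x z : ℝ≥0} (hxz : x < z) : ∃ y ∈ Ioo x z, ContinuousAt f y ∧ ContinuousAt g y := by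
  by_contra! h
  have hcount : (Ioo x z).Countable :=
    (hf.countable_not_continuousAt.union hg.countable_not_continuousAt).mono fun y hy =>
      or_iff_not_imp_left.2 fun hfy => h y hy (not_not.1 hfy)
  have himage : Ioo (x : ℝ) z ⊆ (↑) '' Ioo x z := fun y hy =>
    ⟨⟨y, x.coe_nonneg.trans hy.1.le⟩, hy, rfl⟩
  exact hxz.not_ge (Cardinal.Real.Ioo_countable_iff.1 ((hcount.image _).mono himage))

theorem ext_of_measure_Icc_zero {μ ν : Measure ℝ≥0} (hfin : ∀ x, μ (Icc 0 x) ≠ ∞)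
    (h : ∀ x, μ (Icc 0 x) = ν (Icc 0 x)) : μ = ν := by
  have hIcc (x : ℝ≥0) : Icc 0 x = Iic x := by ext; simp
  simp only [hIcc] at hfin h
  refine Measure.ext_of_generateFrom_of_iUnion (range Iic) (fun n : ℕ => Iic (n : ℝ≥0))
    (borel_eq_generateFrom_Iic ℝ≥0 ▸ BorelSpace.measurable_eq) isPiSystem_Iic
    (eq_univ_of_forall fun y => mem_iUnion.2 (exists_nat_ge y)) (fun n => mem_range_self _)
    (fun n => hfin n) (forall_mem_range.2 h)

theorem tendsto_measure_Icc_nhdsGT {μ : Measure ℝ≥0} (hfin : ∀ x, μ (Icc 0 x) ≠ ∞) (x : ℝ≥0) :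
    Tendsto (fun r => μ (Icc 0 r)) (𝓝[>] x) (𝓝 (μ (Icc 0 x))) := by
  have hinter : ⋂ r > x, Icc 0 r = Icc 0 x := by
    ext y
    simp only [mem_iInter, mem_Icc, zero_le, true_and]
    exact ⟨le_of_forall_gt_imp_ge_of_dense, fun h r hr => h.trans hr.le⟩
  rw [← hinter]
  exact tendsto_measure_biInter_gt (fun r _ => measurableSet_Icc.nullMeasurableSet)
    (fun i j _ hij => Icc_subset_Icc_right hij) ⟨x + 1, by simp, hfin _⟩

namespace ExtLevyMeasure

theorem measure_Icc_ne_top (G : ExtLevyMeasure) (x : ℝ≥0) : G.toMeasure (Icc 0 x) ≠ ∞ := by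
  have hc : min 1 (x : ℝ≥0∞)⁻¹ ≠ 0 := by simp
  refine ne_top_of_le_ne_top (ENNReal.div_ne_top G.isLevy.ne hc)
    ((measure_mono fun y hy => ?_).trans (meas_ge_le_lintegral_div (by fun_prop) hc (by simp)))
  exact min_le_min_left _ (ENNReal.inv_le_inv.2 (ENNReal.coe_le_coe.2 hy.2))

theorem monotone_distrib (G : ExtLevyMeasure) : Monotone G.distrib := fun _ b h =>
  ENNReal.toReal_mono (G.measure_Icc_ne_top b) (measure_mono (Icc_subset_Icc_right h))

theorem eq_of_distrib_eq_of_tail_eq {G G' : ExtLevyMeasure}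
    (h : ∀ x, 0 < x → ContinuousAt G.distrib x → ContinuousAt G'.distrib x →
      G.distrib x = G'.distrib x ∧ G.tail x = G'.tail x) : G = G' := by
  have hIcc (x : ℝ≥0) : G.toMeasure (Icc 0 x) = G'.toMeasure (Icc 0 x) := by
    refine tendsto_nhds_unique_of_frequently_eq (tendsto_measure_Icc_nhdsGT G.measure_Icc_ne_top x)
      (tendsto_measure_Icc_nhdsGT G'.measure_Icc_ne_top x) (frequently_iff.2 fun hU => ?_)
    obtain ⟨z, hz, hzU⟩ := (mem_nhdsGT_iff_exists_Ioo_subset' (lt_add_one x)).1 hU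
    obtain ⟨y, hy, hc, hc'⟩ := exists_continuousAt_of_monotone G.monotone_distrib
      G'.monotone_distrib hz
    exact ⟨y, hzU hy, (ENNReal.toReal_eq_toReal_iff' (G.measure_Icc_ne_top y)
      (G'.measure_Icc_ne_top y)).1 (h y (pos_of_gt hy.1) hc hc').1⟩
  have hmeasure : G.toMeasure = G'.toMeasure := ext_of_measure_Icc_zero G.measure_Icc_ne_top hIcc
  obtain ⟨y, hy, hc, hc'⟩ := exists_continuousAt_of_monotone G.monotone_distrib
    G'.monotone_distrib zero_lt_one
  have htail := (h y hy.1 hc hc').2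
  cases G
  cases G'
  simp_all [tail]

theorem measure_singleton_eq_zero (G : ExtLevyMeasure) {x : ℝ≥0} (hx : 0 < x)
    (hc : ContinuousAt G.distrib x) : G.toMeasure {x} = 0 := by
  have hfin : G.toMeasure {x} ≠ ∞ := measure_ne_top_of_subset (by simp) (G.measure_Icc_ne_top x)
  have hatom : ∀ y < x, G.toMeasure.real {x} ≤ G.distrib x - G.distrib y := by
    intro y hy
    have hdisj : Disjoint {x} (Icc 0 y) := disjoint_singleton_left.2 fun h => h.2.not_gt hy
    have hsub : {x} ∪ Icc 0 y ⊆ Icc 0 x := union_subset (by simp) (Icc_subset_Icc_right hy.le)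
    exact le_sub_iff_add_le.2 <|
      (measureReal_union hdisj measurableSet_Icc hfin (G.measure_Icc_ne_top y)).symm.trans_le
        (measureReal_mono hsub (G.measure_Icc_ne_top x))
  have hlim : Tendsto (fun y => G.distrib x - G.distrib y) (𝓝[<] x) (𝓝 0) := by
    simpa using (hc.tendsto.mono_left nhdsWithin_le_nhds).const_sub (G.distrib x)
  have : (𝓝[<] x).NeBot := nhdsLT_neBot_of_exists_lt ⟨0, hx⟩
  have hle : G.toMeasure.real {x} ≤ 0 := ge_of_tendsto hlim (eventually_mem_nhdsWithin.mono hatom)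
  exact (measureReal_eq_zero_iff hfin).1 (hle.antisymm measureReal_nonneg)

theorem toFiniteMeasure_singleton_eq_zero (G : ExtLevyMeasure) {x : ℝ≥0} (hx : 0 < x)
    (hc : ContinuousAt G.distrib x) : (G.toFiniteMeasure : Measure ℝ≥0∞) {(x : ℝ≥0∞)} = 0 := by
  have hpre : ((↑) : ℝ≥0 → ℝ≥0∞) ⁻¹' {(x : ℝ≥0∞)} = {x} := by ext; simp
  rw [coe_toFiniteMeasure, Measure.add_apply, measurableEmbedding_coe_ennreal.map_apply, hpre,
    withDensity_absolutelyContinuous _ _ (G.measure_singleton_eq_zero hx hc)]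
  simp

section Convergence

variable {ι : Type*} {l : Filter ι} {Gs : ι → ExtLevyMeasure} {G : ExtLevyMeasure} {x : ℝ≥0}

theorem tendsto_distrib (h : Tendsto (fun i => (Gs i).toFiniteMeasure) l (𝓝 G.toFiniteMeasure))
    (hx : 0 < x) (hc : ContinuousAt G.distrib x) :
    Tendsto (fun i => (Gs i).distrib x) l (𝓝 (G.distrib x)) := by
  simp only [distrib_eq_setIntegral]
  exact tendsto_setIntegral_of_null_frontier h
    (measure_mono_null (frontier_Iic_subset _) (G.toFiniteMeasure_singleton_eq_zero hx hc))
    measurableSet_Iic (truncatedOneAdd x)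

theorem tendsto_tail (h : Tendsto (fun i => (Gs i).toFiniteMeasure) l (𝓝 G.toFiniteMeasure))
    (hx : 0 < x) (hc : ContinuousAt G.distrib x) :
    Tendsto (fun i => (Gs i).tail x) l (𝓝 (G.tail x)) := by
  simp only [tail_eq_setIntegral _ hx]
  exact tendsto_setIntegral_of_null_frontier h
    (measure_mono_null (frontier_Ici_subset _) (G.toFiniteMeasure_singleton_eq_zero hx hc))
    measurableSet_Ici ⟨fun z => truncatedOneAdd x⁻¹ z⁻¹, by fun_prop⟩

end Convergence

theorem mass_toFiniteMeasure_le (G : ExtLevyMeasure) {x : ℝ≥0} (hx : 0 < x) :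
    G.toFiniteMeasure.mass ≤ G.distrib x + G.tail x := by
  have hle {A : Set ℝ≥0∞} (hA : MeasurableSet A) {f : ℝ≥0∞ → ℝ≥0} (hf : Continuous f)
      (hone : ∀ z, 1 ≤ f z) : (G.toFiniteMeasure : Measure ℝ≥0∞).real A ≤
        ∫ z in A, (f z : ℝ) ∂(G.toFiniteMeasure : Measure ℝ≥0∞) := by
    have := setIntegral_ge_of_const_le_real (μ := (G.toFiniteMeasure : Measure ℝ≥0∞)) (c := 1) hA
      (by finiteness) (fun z _ => hone z)
      (integrable_continuousMap _ ⟨fun z => (f z : ℝ), by fun_prop⟩).integrableOn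
    simpa using this
  calc (G.toFiniteMeasure : Measure ℝ≥0∞).real univ
      ≤ (G.toFiniteMeasure : Measure ℝ≥0∞).real (Iic x) +
          (G.toFiniteMeasure : Measure ℝ≥0∞).real (Ici x) :=
        Iic_union_Ici (a := (x : ℝ≥0∞)) ▸ measureReal_union_le _ _
    _ ≤ G.distrib x + G.tail x := by
        rw [distrib_eq_setIntegral, tail_eq_setIntegral _ hx]
        exact add_le_add (hle measurableSet_Iic (by fun_prop) (one_le_truncatedOneAdd x))
          (hle measurableSet_Ici (by fun_prop) fun z => one_le_truncatedOneAdd x⁻¹ z⁻¹)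

theorem ConvergesTo.exists_eventually_mass_le {Gs : ℕ → ExtLevyMeasure} {G : ExtLevyMeasure}
    (h : ConvergesTo Gs G) : ∃ C : ℝ≥0, ∀ᶠ n in atTop, (Gs n).toFiniteMeasure.mass ≤ C := by
  obtain ⟨x, hx, hc, -⟩ := exists_continuousAt_of_monotone G.monotone_distrib G.monotone_distrib
    zero_lt_one
  obtain ⟨hdistrib, htail⟩ := h x hx.1 hc
  refine ⟨(G.distrib x + G.tail x + 1).toNNReal, ?_⟩
  filter_upwards [(hdistrib.add htail).eventually_le_const (lt_add_one _)] with n hn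
  exact NNReal.le_toNNReal_of_coe_le (((Gs n).mass_toFiniteMeasure_le hx.1).trans hn)

theorem convergesTo_iff_tendsto_toFiniteMeasure {Gs : ℕ → ExtLevyMeasure} {G : ExtLevyMeasure} :
    ConvergesTo Gs G ↔
      Tendsto (fun n => (Gs n).toFiniteMeasure) atTop (𝓝 G.toFiniteMeasure) := by
  refine ⟨fun h => ?_, fun h x hx hc => ⟨tendsto_distrib h hx hc, tendsto_tail h hx hc⟩⟩
  obtain ⟨C, hC⟩ := h.exists_eventually_mass_le
  have hK := isCompact_setOfPred_finiteMeasure_le_of_compactSpace ℝ≥0∞ C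
  refine hK.tendsto_nhds_of_unique_mapClusterPt hC fun ρ _ hρ => ?_
  obtain ⟨U, hU, hUρ⟩ := mapClusterPt_iff_ultrafilter.1 hρ
  obtain ⟨G', rfl⟩ := surjective_toFiniteMeasure ρ
  refine congrArg _ (eq_of_distrib_eq_of_tail_eq fun x hx hc' hc => ⟨?_, ?_⟩)
  · exact tendsto_nhds_unique (tendsto_distrib hUρ hx hc') ((h x hx hc).1.mono_left hU)
  · exact tendsto_nhds_unique (tendsto_tail hUρ hx hc') ((h x hx hc).2.mono_left hU)

theorem ConvergesTo.tendsto_integralCLM {Gs : ℕ → ExtLevyMeasure} {G : ExtLevyMeasure}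
    (h : ConvergesTo Gs G) (f : C(ℝ≥0∞, ℝ)) :
    Tendsto (fun n => (integralCLM (Gs n).toFiniteMeasure f : ℂ)) atTop
      (𝓝 (integralCLM G.toFiniteMeasure f)) :=
  (Complex.continuous_ofReal.tendsto _).comp
    (tendsto_iff_forall_integralCLM_tendsto.1 (convergesTo_iff_tendsto_toFiniteMeasure.1 h) f)

theorem ConvergesTo.tendsto_laplaceOne {Gs : ℕ → ExtLevyMeasure} {G : ExtLevyMeasure}
    (h : ConvergesTo Gs G) {q : ℝ} (hq : 0 < q) :
    Tendsto (fun n => (Gs n).laplaceOne q) atTop (𝓝 (G.laplaceOne q)) := by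
  lift q to ℝ≥0 using hq.le
  simpa only [laplaceOne_ofReal _ (NNReal.coe_pos.1 hq)] using h.tendsto_integralCLM _

theorem ConvergesTo.tendsto_laplaceTwo {Gs : ℕ → ExtLevyMeasure} {G : ExtLevyMeasure}
    (h : ConvergesTo Gs G) {q : ℝ} (hq : 0 < q) :
    Tendsto (fun n => (Gs n).laplaceTwo q) atTop (𝓝 (G.laplaceTwo q)) := by
  lift q to ℝ≥0 using hq.le
  simpa only [laplaceTwo_ofReal] using h.tendsto_integralCLM _

theorem exists_convergesTo {Gs : ℕ → ExtLevyMeasure} {K : ℝ≥0 → C(ℝ≥0∞, ℝ)}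
    (hK : (Submodule.span ℝ (K '' Ioi 0)).topologicalClosure = ⊤)
    (h : ∀ q, 0 < q → ∃ c : ℂ,
      Tendsto (fun n => (integralCLM (Gs n).toFiniteMeasure (K q) : ℂ)) atTop (𝓝 c)) :
    ∃ G, ConvergesTo Gs G := by
  have hreal : ∀ f ∈ K '' Ioi 0,
      ∃ c, Tendsto (fun n => integralCLM (Gs n).toFiniteMeasure f) atTop (𝓝 c) := by
    rintro _ ⟨q, hq, rfl⟩
    obtain ⟨c, hc⟩ := h q hq
    exact ⟨c.re, (Complex.continuous_re.tendsto c).comp hc⟩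
  obtain ⟨ν, hν⟩ := exists_tendsto_of_forall_exists_tendsto_integralCLM hK hreal
  obtain ⟨G, rfl⟩ := surjective_toFiniteMeasure ν
  exact ⟨G, convergesTo_iff_tendsto_toFiniteMeasure.2 hν⟩

end ExtLevyMeasure

theorem theorem3p1 (Gs : ℕ → ExtLevyMeasure) :
    List.TFAE [
      ∃ G : ExtLevyMeasure, ExtLevyMeasure.ConvergesTo Gs G,
      ∀ q : ℝ, 0 < q → ∃ l : ℂ,
        Tendsto (fun n => (Gs n).laplaceOne (q : ℂ)) atTop (𝓝 l),
      ∀ q : ℝ, 0 < q → ∃ l : ℂ,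
        Tendsto (fun n => (Gs n).laplaceTwo (q : ℂ)) atTop (𝓝 l)] ∧
    ∀ G : ExtLevyMeasure, ExtLevyMeasure.ConvergesTo Gs G →
      ∀ q : ℝ, 0 < q →
        Tendsto (fun n => (Gs n).laplaceOne (q : ℂ)) atTop (𝓝 (G.laplaceOne (q : ℂ))) ∧
        Tendsto (fun n => (Gs n).laplaceTwo (q : ℂ)) atTop (𝓝 (G.laplaceTwo (q : ℂ))) := by
  refine ⟨?_, fun G h q hq => ⟨h.tendsto_laplaceOne hq, h.tendsto_laplaceTwo hq⟩⟩
  tfae_have 1 → 2 := fun ⟨_, h⟩ _ hq => ⟨_, h.tendsto_laplaceOne hq⟩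
  tfae_have 1 → 3 := fun ⟨_, h⟩ _ hq => ⟨_, h.tendsto_laplaceTwo hq⟩
  tfae_have 2 → 1 := fun h =>
    ExtLevyMeasure.exists_convergesTo topologicalClosure_span_laplaceKernelOne fun q hq => by
      simpa only [ExtLevyMeasure.laplaceOne_ofReal _ hq] using h q hq
  tfae_have 3 → 1 := fun h =>
    ExtLevyMeasure.exists_convergesTo topologicalClosure_span_laplaceKernelTwo fun q hq => by
      simpa only [ExtLevyMeasure.laplaceTwo_ofReal] using h q hq
  tfae_finish
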